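/- Let $p$ be a prime and let $k$ be an algebraically closed field of characteristic $p$. Let $X$ be a finite group of order divisible by $p$ such that $O_{p'}(X) = 1$ (that is, $X$ has no non-trivial normal subgroup of order prime to $p$), and suppose that $X$ has a strongly $p$-embedded subgroup $Y$, that is, a proper subgroup $Y$ of order divisible by $p$ such that $Y \cap g^{-1}Yg$ has order prime to $p$ for every $g \in X \setminus Y$. Then there is a finite group $G$ whose generalized Fitting subgroup $A = F^{*}(G)$ is an Abelian group of order prime to $p$, with $G/A \cong X$, and there is a simple endotrivial $kG$-module which is induced from a $1$-dimensional $kH$-module for some proper subgroup $H$ of $G$. Here $F^{*}(G) = F(G)E(G)$, where $F(G)$ is the largest nilpotent normal subgroup of $G$ and $E(G)$ is the subgroup generated by the components (the quasi-simple subnormal subgroups) of $G$; and a finite-dimensional $kG$-module $M$ is endotrivial if $M \otimes_k M^{*} \cong k \oplus S$ with $k$ the trivial module and $S$ a projective $kG$-module. -/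

import Mathlib

open scoped Pointwise MonoidAlgebra

universe u v

/-- The proper subgroup `H` of `G` is strongly `p`-embedded: `p` divides `|H|`, but
`H ∩ H ^ g` is a `p'`-group for every `g` outside `H` (where `H ^ g = g⁻¹ H g`). -/
def IsStronglyEmbedded {G : Type*} [Group G] (p : ℕ) (H : Subgroup G) : Prop :=
  H ≠ ⊤ ∧ p ∣ Nat.card H ∧
    ∀ g : G, g ∉ H → ¬ p ∣ Nat.card (H ⊓ MulAut.conj g⁻¹ • H : Subgroup G)

/-- `O_{p'}(G)`, the subgroup generated by all normal `p'`-subgroups; for finite `G` and prime `p`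
it is the largest normal `p'`-subgroup. -/
def pPrimeCore (p : ℕ) (G : Type*) [Group G] : Subgroup G :=
  sSup {N : Subgroup G | N.Normal ∧ ¬ p ∣ Nat.card N}

/-- `F(G)`, the subgroup generated by all nilpotent normal subgroups; for finite `G` it is the
largest nilpotent normal subgroup. -/
def fittingSubgroup (G : Type*) [Group G] : Subgroup G :=
  sSup {N : Subgroup G | N.Normal ∧ Group.IsNilpotent N}

/-- A group is quasi-simple if it is perfect and simple modulo its centre. -/
def IsQuasiSimpleGroup (L : Type*) [Group L] : Prop :=
  Group.IsPerfect L ∧ IsSimpleGroup (L ⧸ Subgroup.center L)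

/-- `E(G)`, the subgroup generated by the components (quasi-simple subnormal subgroups). -/
def layer (G : Type*) [Group G] : Subgroup G :=
  sSup {L : Subgroup G | L.IsSubnormal ∧ IsQuasiSimpleGroup L}

/-- The generalized Fitting subgroup `F*(G) = F(G) E(G)`. -/
def generalizedFittingSubgroup (G : Type*) [Group G] : Subgroup G :=
  fittingSubgroup G ⊔ layer G

/-- A finite-dimensional `kG`-module `M` is endotrivial if `M ⊗ M*` is the (internal) direct sum
of a submodule isomorphic to the trivial module `k` and a projective submodule. -/
def IsEndotrivial {k G M : Type*} [Field k] [Group G] [AddCommGroup M] [Module k M]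
    (ρ : Representation k G M) : Prop :=
  FiniteDimensional k M ∧
    ∃ T P : Submodule k[G] (ρ.tprod ρ.dual).asModule,
      IsCompl T P ∧
      Nonempty (T ≃ₗ[k[G]] (Representation.trivial k G k).asModule) ∧
      Module.Projective k[G] P

/-! For a prime `q ≠ p`, let `C` be cyclic of order `q`, `Ω = X ⧸ Y`, `G = C ≀ X` over `Ω` and `A`
the base group. A nontrivial character `χ` of `C` gives a monomial module on `k^Ω`, induced from a
linear character of `C ≀ Y`. It is simple because the base group separates the coordinate lines and
`X` permutes them transitively.

Strong embedding says that an element of order `p` fixes at most one point of `Ω`. Hence `|Ω|` is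
prime to `p`, pairs of distinct points have `p'`-stabilizers, and `X` is faithful on `Ω` since
`O_{p'}(X) = 1`. Faithfulness makes `A` self-centralizing, which forces `F*(G) = A`
(`generalizedFittingSubgroup_eq_ker`).

For endotriviality (`monomialRep_isEndotrivial`), view `V ⊗ V*` as `Ω × Ω` matrices. The trace
splits off `k` because `|Ω|` is invertible. The trace-zero part is projective by Higman's criterion,
with an operator built from a weight on off-diagonal pairs. -/

section GroupTheory

variable {G : Type*} [Group G]

/-! ### Components and the generalized Fitting subgroup -/

namespace Subgroup

/-- Iterated commutators of `A` with a subnormal subgroup `H` eventually fall into `H`. -/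
theorem IsSubnormal.exists_iterate_commutator_le {H : Subgroup G} (hH : H.IsSubnormal)
    (A : Subgroup G) : ∃ n : ℕ, (fun B ↦ ⁅B, H⁆)^[n] A ≤ H := by
  induction hH with
  | top => exact ⟨0, le_top⟩
  | step H K hHK _ hN ih =>
    obtain ⟨n, hn⟩ := ih
    have hmono : (fun B ↦ ⁅B, H⁆)^[n] A ≤ (fun B ↦ ⁅B, K⁆)^[n] A := by
      clear hn
      induction n with
      | zero => exact le_rfl
      | succ n ih =>
        simp only [Function.iterate_succ', Function.comp_apply]
        exact commutator_mono ih hHK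
    refine ⟨n + 1, ?_⟩
    rw [Function.iterate_succ', Function.comp_apply, commutator_comm]
    refine (commutator_mono le_rfl (hmono.trans hn)).trans ?_
    rw [normal_subgroupOf_iff_le_normalizer hHK] at hN
    exact le_normalizer_iff_commutator_le_left.mp hN

end Subgroup

/-- Otherwise `B` would cover the simple quotient by the centre, which would then be perfect and
commutative, hence trivial. -/
theorem IsQuasiSimpleGroup.le_center_of_normal_of_isMulCommutative {L : Type*} [Group L]
    (hL : IsQuasiSimpleGroup L) (B : Subgroup L) [B.Normal] [IsMulCommutative B] :
    B ≤ Subgroup.center L := by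
  obtain ⟨hperf, hsimple⟩ := hL
  set f := QuotientGroup.mk' (Subgroup.center L)
  have hn : (B.map f).Normal :=
    Subgroup.Normal.map inferInstance f (QuotientGroup.mk'_surjective _)
  rcases hn.eq_bot_or_eq_top with h | h
  · rwa [Subgroup.map_eq_bot_iff, QuotientGroup.ker_mk'] at h
  · have hcomm : IsMulCommutative (L ⧸ Subgroup.center L) := by
      refine ⟨⟨fun a b ↦ ?_⟩⟩
      have ha : a ∈ B.map f := h ▸ Subgroup.mem_top a
      have hb : b ∈ B.map f := h ▸ Subgroup.mem_top b
      obtain ⟨a, ha, rfl⟩ := ha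
      obtain ⟨b, hb, rfl⟩ := hb
      rw [← map_mul, ← map_mul, setLike_mul_comm ha hb]
    exact absurd (Group.IsPerfect.subsingleton_of_isMulCommutative (G := L ⧸ Subgroup.center L))
      (not_subsingleton_iff_nontrivial.mpr inferInstance)

/-- A component of a group centralizes every abelian normal subgroup. -/
theorem Subgroup.IsSubnormal.commutator_eq_bot_of_isQuasiSimpleGroup {L : Subgroup G}
    (hs : L.IsSubnormal) (hL : IsQuasiSimpleGroup L) (A : Subgroup G) [A.Normal]
    [IsMulCommutative A] : ⁅A, L⁆ = ⊥ := by
  have hperf : ⁅L, L⁆ = L := Subgroup.isPerfect_iff.mp hL.1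
  -- Three subgroups lemma, using that `L` is perfect.
  have hstep : ∀ B : Subgroup G, ⁅⁅B, L⁆, L⁆ = ⊥ → ⁅B, L⁆ = ⊥ := fun B hB ↦ by
    have h := Subgroup.commutator_commutator_eq_bot_of_rotate (H₁ := L) (H₂ := L) (H₃ := B)
      (by rwa [Subgroup.commutator_comm L B]) hB
    rwa [hperf, Subgroup.commutator_comm] at h
  have hinter : ⁅A ⊓ L, L⁆ = ⊥ := by
    have hB : IsMulCommutative (A.subgroupOf L) := by
      refine ⟨⟨fun a b ↦ ?_⟩⟩
      ext
      exact setLike_mul_comm (s := A) a.2 b.2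
    have hc := hL.le_center_of_normal_of_isMulCommutative (A.subgroupOf L)
    rw [Subgroup.commutator_eq_bot_iff_le_centralizer]
    rintro a ⟨haA, haL⟩
    rw [Subgroup.mem_centralizer_iff]
    intro l hl
    have := Subgroup.mem_center_iff.mp (hc (x := ⟨a, haL⟩) haA) ⟨l, hl⟩
    exact congrArg Subtype.val this
  -- Iterated commutators of `A` with `L` land in `A ⊓ L`, which centralizes `L`; `hstep` then peels
  -- them off one at a time.
  obtain ⟨n, hn⟩ := hs.exists_iterate_commutator_le A
  have hA : ∀ n : ℕ, (fun B ↦ ⁅B, L⁆)^[n] A ≤ A := fun n ↦ by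
    induction n with
    | zero => exact le_rfl
    | succ n ih =>
      rw [Function.iterate_succ', Function.comp_apply]
      exact (Subgroup.commutator_mono ih le_rfl).trans (Subgroup.commutator_le_left A L)
  have hbot : ⁅(fun B ↦ ⁅B, L⁆)^[n] A, L⁆ = ⊥ :=
    le_bot_iff.mp ((Subgroup.commutator_mono (le_inf (hA n) hn) le_rfl).trans hinter.le)
  clear hn
  induction n with
  | zero => exact hbot
  | succ n ih =>
    rw [Function.iterate_succ', Function.comp_apply] at hbot
    exact ih (hstep _ hbot)

/-- Let `A` be a self-centralizing abelian normal `p'`-subgroup, the kernel of a surjection onto a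
group without normal `p'`-subgroups. Then `A` is the generalized Fitting subgroup. -/
theorem generalizedFittingSubgroup_eq_ker {X : Type*} [Group X] [Finite G] (p : ℕ) [Fact p.Prime]
    (π : G →* X) (hπ : Function.Surjective π) (hX : pPrimeCore p X = ⊥) [IsMulCommutative π.ker]
    (hp : ¬ p ∣ Nat.card π.ker) (hc : Subgroup.centralizer (π.ker : Set G) ≤ π.ker) :
    generalizedFittingSubgroup G = π.ker := by
  refine le_antisymm (sup_le (sSup_le ?_) (sSup_le ?_)) (le_sup_of_le_left (le_sSup ?_))
  · rintro N ⟨hN, hnil⟩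
    -- The Sylow `p`-subgroup of `N` is normal in `G` and meets the `p'`-group `π.ker` trivially, so
    -- it centralizes `π.ker`, lies in it, and vanishes. Thus `N` is a `p'`-group and so is its
    -- image in `X`.
    let S : Sylow p N := default
    have hS : S.Normal := Group.isNilpotent_of_finite_tfae.out 0 3 rfl rfl |>.mp hnil p ‹_› S
    have hSchar := S.characteristic_of_normal hS
    have hSN : ((S : Subgroup N).map N.subtype).Normal := inferInstance
    have hSp : IsPGroup p ((S : Subgroup N).map N.subtype) := S.2.map _
    have hcop : Disjoint ((S : Subgroup N).map N.subtype) π.ker := by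
      obtain ⟨n, hn⟩ := IsPGroup.iff_card.mp hSp
      refine Subgroup.disjoint_of_coprime_natCard ?_
      rw [hn]
      exact Nat.Coprime.pow_left _ ((Nat.Prime.coprime_iff_not_dvd Fact.out).mpr hp)
    have hle : (S : Subgroup N).map N.subtype ≤ π.ker := by
      refine le_trans (Subgroup.commutator_eq_bot_iff_le_centralizer.mp ?_) hc
      exact Subgroup.commutator_eq_bot_of_disjoint hcop
    have hSbot : (S : Subgroup N) = ⊥ := by
      have := le_bot_iff.mp (hcop le_rfl hle)
      rwa [Subgroup.map_eq_bot_iff_of_injective _ N.subtype_injective] at this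
    have hpN : ¬ p ∣ Nat.card N :=
      fun h ↦ S.ne_bot_of_dvd_card h hSbot
    rw [← Subgroup.map_eq_bot_iff, ← le_bot_iff, ← hX]
    refine le_sSup ⟨hN.map π hπ, fun h ↦ hpN (h.trans ?_)⟩
    exact Subgroup.card_map_dvd _ _
  · rintro L ⟨hs, hL⟩
    refine le_trans ?_ hc
    rw [← Subgroup.commutator_eq_bot_iff_le_centralizer, Subgroup.commutator_comm]
    exact hs.commutator_eq_bot_of_isQuasiSimpleGroup hL _
  · let _ : CommGroup π.ker := { mul_comm := fun a b ↦ mul_comm' a b }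
    exact ⟨inferInstance, CommGroup.isNilpotent⟩

/-! ### Action on the cosets of a strongly embedded subgroup -/

/-- An element of order `p` fixes at most one coset of a strongly `p`-embedded subgroup. -/
theorem IsStronglyEmbedded.eq_of_smul_eq [Finite G] {p : ℕ} {H : Subgroup G}
    (hH : IsStronglyEmbedded p H) {t : G} (ht : orderOf t = p) {x y : G ⧸ H} (hx : t • x = x)
    (hy : t • y = y) : x = y := by
  obtain ⟨a, rfl⟩ := QuotientGroup.mk_surjective x
  obtain ⟨b, rfl⟩ := QuotientGroup.mk_surjective y
  have conj_mem : ∀ c : G, t • (c : G ⧸ H) = c → c⁻¹ * t * c ∈ H := fun c hc ↦ by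
    rw [mul_assoc]
    exact QuotientGroup.eq.mp hc.symm
  rw [QuotientGroup.eq]
  by_contra hab
  refine hH.2.2 (b⁻¹ * a) (fun h ↦ hab ?_) ?_
  · simpa using H.inv_mem h
  have hmem : a⁻¹ * t * a ∈ H ⊓ MulAut.conj (b⁻¹ * a)⁻¹ • H := by
    refine ⟨conj_mem a hx, Subgroup.mem_pointwise_smul_iff_inv_smul_mem.mpr ?_⟩
    have := conj_mem b hy
    simpa [← map_inv, MulAut.smul_def, mul_assoc] using this
  have ho : orderOf (a⁻¹ * t * a) = p := by
    rw [← ht, ← MulAut.conj_inv_apply]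
    exact MulEquiv.orderOf_eq _ t
  rw [← ho, ← Subgroup.orderOf_mk _ hmem]
  exact orderOf_dvd_natCard _

/-- The stabilizer of a pair of distinct cosets of a strongly `p`-embedded subgroup is a
`p'`-group. -/
theorem IsStronglyEmbedded.not_dvd_card_stabilizer [Finite G] {p : ℕ} [Fact p.Prime]
    {H : Subgroup G} (hH : IsStronglyEmbedded p H) {z : (G ⧸ H) × (G ⧸ H)} (hz : z.1 ≠ z.2) :
    ¬ p ∣ Nat.card (MulAction.stabilizer G z) := fun hp ↦ by
  obtain ⟨t, ht⟩ := exists_prime_orderOf_dvd_card' p hp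
  have hfix : (t : G) • z = z := t.2
  exact hz (hH.eq_of_smul_eq ((Subgroup.orderOf_coe t).trans ht) (congrArg Prod.fst hfix)
    (congrArg Prod.snd hfix))

/-- An element of order `p` in `H` fixes the base coset and no other, so the index is `1` modulo
`p`. -/
theorem IsStronglyEmbedded.not_dvd_card_quotient [Finite G] {p : ℕ} [Fact p.Prime]
    {H : Subgroup G} (hH : IsStronglyEmbedded p H) : ¬ p ∣ Nat.card (G ⧸ H) := by
  obtain ⟨t, ht⟩ := exists_prime_orderOf_dvd_card' p hH.2.1
  have ht' : orderOf (t : G) = p := by simpa using ht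
  have hP : IsPGroup p (Subgroup.zpowers (t : G)) :=
    IsPGroup.of_card (n := 1) (by rw [Nat.card_zpowers, ht', pow_one])
  have hone : Nat.card (MulAction.fixedPoints (Subgroup.zpowers (t : G)) (G ⧸ H)) = 1 := by
    have hfix : ∀ x : MulAction.fixedPoints (Subgroup.zpowers (t : G)) (G ⧸ H),
        (t : G) • (x : G ⧸ H) = x := fun x ↦ x.2 ⟨t, Subgroup.mem_zpowers _⟩
    rw [Nat.card_eq_one_iff_unique]
    refine ⟨⟨fun x y ↦ Subtype.ext (hH.eq_of_smul_eq ht' (hfix x) (hfix y))⟩,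
      ⟨⟨((1 : G) : G ⧸ H), ?_⟩⟩⟩
    rintro ⟨g, hg⟩
    have hgH : g ∈ H := (Subgroup.zpowers_le.mpr t.2) hg
    exact QuotientGroup.eq.mpr (by simpa using hgH)
  have hmod := hP.card_modEq_card_fixedPoints (G ⧸ H)
  rw [hone] at hmod
  intro hdvd
  have h1 := (Nat.modEq_zero_iff_dvd.mpr hdvd).symm.trans hmod
  exact (Fact.out : p.Prime).one_lt.ne' (Nat.dvd_one.mp ((Nat.modEq_zero_iff_dvd).mp h1.symm))

/-- A group without normal `p'`-subgroups acts faithfully on the cosets of a strongly `p`-embedded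
subgroup. -/
theorem IsStronglyEmbedded.eq_one_of_forall_smul_eq [Finite G] {p : ℕ} [Fact p.Prime]
    {H : Subgroup G} (hH : IsStronglyEmbedded p H) (hG : pPrimeCore p G = ⊥) {g : G}
    (hg : ∀ x : G ⧸ H, g • x = x) : g = 1 := by
  have hmem : g ∈ (MulAction.toPermHom G (G ⧸ H)).ker := Equiv.ext hg
  rw [← Subgroup.mem_bot, ← hG]
  suffices hp : ¬ p ∣ Nat.card (MulAction.toPermHom G (G ⧸ H)).ker by
    have hle : (MulAction.toPermHom G (G ⧸ H)).ker ≤ pPrimeCore p G :=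
      le_sSup ⟨inferInstance, hp⟩
    exact hle hmem
  refine fun hp ↦ hH.1 ?_
  obtain ⟨t, ht⟩ := exists_prime_orderOf_dvd_card' p hp
  have hfix : ∀ x : G ⧸ H, (t : G) • x = x := Equiv.ext_iff.mp t.2
  refine (Subgroup.eq_top_iff' H).mpr fun a ↦ ?_
  have := hH.eq_of_smul_eq ((Subgroup.orderOf_coe t).trans ht) (hfix ((1 : G) : G ⧸ H)) (hfix a)
  simpa using QuotientGroup.eq.mp this

end GroupTheory

/-! ### Higman's criterion and endotriviality -/

section Projectivity

/-- A finite group acting with stabilizers of invertible order on a `G`-stable set `S` admits a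
`k`-valued weight whose sum over the group is `1` at every point of `S`. -/
theorem exists_weight_sum_eq_one (k : Type*) [Field k] {G Ω : Type*} [Group G] [Fintype G]
    [MulAction G Ω] {S : Set Ω} (hS : ∀ (g : G), ∀ z ∈ S, g • z ∈ S)
    (hstab : ∀ z ∈ S, (Nat.card (MulAction.stabilizer G z) : k) ≠ 0) :
    ∃ w : Ω → k, ∀ z ∈ S, ∑ g : G, w (g • z) = 1 := by
  classical
  let r : Ω → Ω := fun z ↦ (Quotient.mk (MulAction.orbitRel G Ω) z).out
  have hr : ∀ z, ∃ g : G, g • r z = z := fun z ↦ by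
    have h := Quotient.mk_out (s := MulAction.orbitRel G Ω) z
    exact MulAction.mem_orbit_iff.mp (MulAction.mem_orbit_symm.mp h)
  have hrg : ∀ (g : G) z, r (g • z) = r z := fun g z ↦
    congrArg Quotient.out (Quotient.sound (s := MulAction.orbitRel G Ω) ⟨g, rfl⟩)
  -- The weight lives on orbit representatives; exactly `|Stab|` group elements carry a point to its
  -- representative, whence the reciprocal.
  refine ⟨fun z ↦ if z = r z then (Nat.card (MulAction.stabilizer G z) : k)⁻¹ else 0,
    fun z hz ↦ ?_⟩
  obtain ⟨h, hh⟩ := hr z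
  have hrz : r z ∈ S := by
    rw [← inv_smul_eq_iff.mpr hh.symm]
    exact hS _ _ hz
  have hterm : ∀ g : G, (if g • z = r (g • z) then
      (Nat.card (MulAction.stabilizer G (g • z)) : k)⁻¹ else 0) =
      if (g * h) • r z = r z then (Nat.card (MulAction.stabilizer G (r z)) : k)⁻¹ else 0 :=
    fun g ↦ by
      rw [hrg, mul_smul, hh]
      split_ifs with h1
      · rw [h1]
      · rfl
  simp only [hterm]
  refine (Equiv.sum_comp (Equiv.mulRight h) (fun g : G ↦ if g • r z = r z then
    (Nat.card (MulAction.stabilizer G (r z)) : k)⁻¹ else 0)).trans ?_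
  have hcard : (Finset.univ.filter fun g : G ↦ g • r z = r z).card =
      Nat.card (MulAction.stabilizer G (r z)) := by
    rw [← Fintype.card_subtype, ← Nat.card_eq_fintype_card]
    rfl
  rw [Finset.sum_ite, Finset.sum_const_zero, add_zero, Finset.sum_const, nsmul_eq_mul, hcard,
    mul_inv_cancel₀ (hstab _ hrz)]

/-- **Higman's criterion**: a module over a group algebra whose identity map is a sum of conjugates
of a linear endomorphism is projective. -/
theorem Module.Projective.of_sumOfConjugates_eq_id {k G M : Type*} [Field k] [Group G] [Fintype G]
    [AddCommGroup M] [Module k M] [Module k[G] M] [IsScalarTower k k[G] M] (φ : M →ₗ[k] M)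
    (hφ : ∀ m, φ.sumOfConjugates G m = m) : Module.Projective k[G] M := by
  let b := Module.Basis.ofVectorSpace k M
  let s : M →ₗ[k] (Module.Basis.ofVectorSpaceIndex k M →₀ k[G]) :=
    Finsupp.mapRange.linearMap (Algebra.linearMap k k[G]) ∘ₗ b.repr.toLinearMap
  let π : (Module.Basis.ofVectorSpaceIndex k M →₀ k[G]) →ₗ[k[G]] M :=
    Finsupp.linearCombination k[G] b
  have hπs : ∀ m, π (s m) = m := fun m ↦ by
    have : (π.restrictScalars k) ∘ₗ s = LinearMap.id := by
      refine b.ext fun i ↦ ?_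
      simp [π, s, ← MonoidAlgebra.one_def]
    exact LinearMap.congr_fun this m
  -- The section `s` is only `k`-linear. Since `π` is equivariant, composing it with the sum of
  -- conjugates of `s ∘ φ` gives that of `φ`, the identity.
  refine Module.Projective.of_split ((s ∘ₗ φ).sumOfConjugatesEquivariant G) π ?_
  ext m
  rw [LinearMap.comp_apply, LinearMap.sumOfConjugatesEquivariant_apply, map_sum, LinearMap.id_apply]
  conv_rhs => rw [← hφ m, LinearMap.sumOfConjugates_apply]
  refine Finset.sum_congr rfl fun g _ ↦ ?_
  rw [LinearMap.conjugate_apply, LinearMap.conjugate_apply, map_smul, LinearMap.comp_apply, hπs]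

/-- A splitting `k → M ⊗ M* → k` whose kernel satisfies Higman's criterion makes `M`
endotrivial. -/
theorem IsEndotrivial.of_splitting {k G V : Type*} [Field k] [Group G] [Fintype G]
    [AddCommGroup V] [Module k V] [FiniteDimensional k V] {ρ : Representation k G V}
    (ι : (Representation.trivial k G k).IntertwiningMap (ρ.tprod ρ.dual))
    (tr : (ρ.tprod ρ.dual).IntertwiningMap (Representation.trivial k G k))
    (htr : ∀ c, tr (ι c) = c)
    (ψ : TensorProduct k V (Module.Dual k V) →ₗ[k] TensorProduct k V (Module.Dual k V))
    (hψ : ∀ m, tr m = 0 →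
      ∑ g : G, (ρ.tprod ρ.dual) g⁻¹ (ψ ((ρ.tprod ρ.dual) g m)) = m) :
    IsEndotrivial ρ := by
  refine ⟨inferInstance, ?_⟩
  let i := Representation.IntertwiningMap.equivLinearMapAsModule _ _ ι
  let t := Representation.IntertwiningMap.equivLinearMapAsModule _ _ tr
  have hti : ∀ c, t (i c) = c := htr
  let π : (ρ.tprod ρ.dual).asModule →ₗ[k[G]] LinearMap.ker t :=
    (LinearMap.id - i ∘ₗ t).codRestrict _ fun m ↦ by simp [hti]
  have hπ : ∀ m : LinearMap.ker t, π m = m := fun m ↦ by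
    ext
    simp [π]
  refine ⟨LinearMap.range i, LinearMap.ker t, ?_,
    ⟨(LinearEquiv.ofInjective i (Function.LeftInverse.injective hti)).symm⟩, ?_⟩
  · constructor
    · rw [Submodule.disjoint_def]
      rintro _ ⟨c, rfl⟩ hc
      rw [LinearMap.mem_ker, hti] at hc
      rw [hc, map_zero]
    · rw [codisjoint_iff, Submodule.eq_top_iff']
      intro m
      exact Submodule.mem_sup.mpr ⟨i (t m), ⟨_, rfl⟩, m - i (t m), by simp [hti], by simp⟩
  -- `ψ` need not preserve the kernel; compressing it by the equivariant projection `π` retains the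
  -- averaging identity.
  · let φ : (ρ.tprod ρ.dual).asModule →ₗ[k] (ρ.tprod ρ.dual).asModule := ψ
    let φ' : LinearMap.ker t →ₗ[k] LinearMap.ker t :=
      π.restrictScalars k ∘ₗ φ ∘ₗ (LinearMap.ker t).subtype.restrictScalars k
    refine Module.Projective.of_sumOfConjugates_eq_id (k := k) (G := G)
      (M := LinearMap.ker t) φ' fun m ↦ ?_
    rw [LinearMap.sumOfConjugates_apply]
    conv_rhs => rw [← hπ m, ← hψ m.1 m.2]
    refine (Finset.sum_congr rfl fun g _ ↦ ?_).trans (map_sum π _ _).symm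
    rw [LinearMap.conjugate_apply, LinearMap.comp_apply, LinearMap.restrictScalars_apply,
      ← map_smul]
    have hm : ((MonoidAlgebra.single g (1 : k) • m : LinearMap.ker t) :
        (ρ.tprod ρ.dual).asModule) = (ρ.tprod ρ.dual) g m.1 := by
      rw [Submodule.coe_smul, Representation.single_smul, one_smul]
      rfl
    rw [Representation.single_smul, one_smul]
    exact congrArg (fun x ↦ π ((ρ.tprod ρ.dual) g⁻¹ (ψ x))) hm

end Projectivity

/-! ### The monomial module: simplicity and endotriviality -/

section Monomial

variable {k : Type u} [Field k] {X Ω C : Type*} [Group X] [MulAction X Ω] [CommGroup C]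

/-- The wreath product of `C` with `X` along the action of `X` on `Ω`. -/
abbrev PermWreath (C X Ω : Type*) [Group X] [MulAction X Ω] [CommGroup C] : Type _ :=
  (Ω → C) ⋊[mulAutArrow] X

/-- The monomial representation of a permutational wreath product on `Ω → k` attached to a linear
character of the base group. -/
def monomialRep (χ : C →* kˣ) : Representation k (PermWreath C X Ω) (Ω → k) where
  toFun g :=
    { toFun := fun f ω ↦ χ (g.left ω) * f (g.right⁻¹ • ω)
      map_add' := fun _ _ ↦ by ext; simp [mul_add]
      map_smul' := fun _ _ ↦ by ext; simp [mul_left_comm] }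
  map_one' := by ext; simp
  map_mul' g h := by
    ext
    simp [mul_smul, mul_assoc]
    exact .inl rfl

theorem monomialRep_apply (χ : C →* kˣ) (g : PermWreath C X Ω) (f : Ω → k) (ω : Ω) :
    monomialRep χ g f ω = χ (g.left ω) * f (g.right⁻¹ • ω) := rfl


theorem PermWreath.inv_left_apply (g : PermWreath C X Ω) (ω : Ω) :
    (g⁻¹).left ω = (g.left (g.right • ω))⁻¹ := by
  rw [SemidirectProduct.inv_left]
  change (g.left⁻¹) ((g.right⁻¹)⁻¹ • ω) = _
  simp

theorem monomialRep_single [DecidableEq Ω] (χ : C →* kˣ) (g : PermWreath C X Ω) (ω : Ω) (c : k) :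
    monomialRep χ g (Pi.single ω c) =
      Pi.single (g.right • ω) (χ (g.left (g.right • ω)) * c) := by
  ext x
  rw [monomialRep_apply]
  by_cases h : x = g.right • ω
  · subst h
    simp
  · rw [Pi.single_eq_of_ne h, Pi.single_eq_of_ne, mul_zero]
    rwa [ne_eq, inv_smul_eq_iff]

/-- If `f ω ≠ 0`, the base element equal to `c` at `ω` and `1` elsewhere, minus the identity, sends
`f` to a nonzero multiple of the basis vector at `ω`; transitivity yields the others. -/
theorem monomialRep_isIrreducible [Finite Ω] [Nonempty Ω] [MulAction.IsPretransitive X Ω]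
    {χ : C →* kˣ} {c : C} (hc : χ c ≠ 1) :
    (monomialRep χ : Representation k (PermWreath C X Ω) (Ω → k)).IsIrreducible := by
  classical
  have : Fintype Ω := Fintype.ofFinite Ω
  have hne : (⊥ : Subrepresentation (monomialRep χ :
      Representation k (PermWreath C X Ω) (Ω → k))) ≠ ⊤ := fun h ↦ by
    have h1 : (1 : Ω → k) ∈ (⊥ : Subrepresentation (monomialRep χ :
        Representation k (PermWreath C X Ω) (Ω → k))) := h ▸ Submodule.mem_top
    have h2 : (1 : Ω → k) = 0 := h1
    exact one_ne_zero (congrFun h2 (Classical.arbitrary Ω))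
  have : Nontrivial (Subrepresentation (monomialRep χ :
    Representation k (PermWreath C X Ω) (Ω → k))) := ⟨⟨_, _, hne⟩⟩
  refine ⟨fun W ↦ or_iff_not_imp_left.mpr fun hW ↦ ?_⟩
  obtain ⟨f, hf, hf0⟩ : ∃ f ∈ W.toSubmodule, f ≠ 0 := by
    refine W.toSubmodule.exists_mem_ne_zero_of_ne_bot fun h ↦ hW ?_
    exact Subrepresentation.toSubmodule_injective h
  obtain ⟨ω, hω⟩ := Function.ne_iff.mp hf0
  have hdelta : (Pi.single ω 1 : Ω → k) ∈ W.toSubmodule := by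
    have h1 := W.toSubmodule.sub_mem
      (W.apply_mem_toSubmodule (SemidirectProduct.inl (Pi.mulSingle ω c)) hf) hf
    have h2 : monomialRep χ (SemidirectProduct.inl (Pi.mulSingle ω c) : PermWreath C X Ω) f - f =
        Pi.single ω ((χ c - 1) * f ω) := by
      ext x
      rw [Pi.sub_apply, monomialRep_apply]
      by_cases h : x = ω
      · subst h
        simp [sub_mul]
      · simp [h]
    rw [h2] at h1
    have hne : ((χ c : k) - 1) * f ω ≠ 0 :=
      mul_ne_zero (sub_ne_zero.mpr fun h ↦ hc (Units.ext h)) hω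
    have h3 := W.toSubmodule.smul_mem (((χ c : k) - 1) * f ω)⁻¹ h1
    rwa [← Pi.single_smul, smul_eq_mul, inv_mul_cancel₀ hne] at h3
  have hall : ∀ x : Ω, (Pi.single x 1 : Ω → k) ∈ W.toSubmodule := fun x ↦ by
    obtain ⟨g, rfl⟩ := MulAction.exists_smul_eq X ω x
    have h := W.apply_mem_toSubmodule (SemidirectProduct.inr g) hdelta
    rw [monomialRep_single] at h
    simpa using h
  refine Subrepresentation.toSubmodule_injective (eq_top_iff.mpr fun f _ ↦ ?_)
  rw [pi_eq_sum_univ' f]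
  refine W.toSubmodule.sum_mem fun x _ ↦ W.toSubmodule.smul_mem _ ?_
  convert hall x using 1

/-- The matrix coefficients of a tensor in `(Ω → k) ⊗ (Ω → k)*`. -/
noncomputable def tensorDualMatrix (k Ω : Type*) [Field k] [Fintype Ω] [DecidableEq Ω] :
    TensorProduct k (Ω → k) (Module.Dual k (Ω → k)) ≃ₗ[k] Matrix Ω Ω k :=
  TensorProduct.comm k _ _ ≪≫ₗ dualTensorHomEquiv k _ _ ≪≫ₗ LinearMap.toMatrix'

theorem tensorDualMatrix_tmul [Fintype Ω] [DecidableEq Ω] (v : Ω → k) (f : Module.Dual k (Ω → k))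
    (x y : Ω) : tensorDualMatrix k Ω (v ⊗ₜ[k] f) x y = f (Pi.single y 1) * v x := by
  simp [tensorDualMatrix, LinearMap.toMatrix'_apply]

theorem tensorDualMatrix_monomialRep [Fintype Ω] [DecidableEq Ω] (χ : C →* kˣ)
    (g : PermWreath C X Ω) (m : TensorProduct k (Ω → k) (Module.Dual k (Ω → k))) (x y : Ω) :
    tensorDualMatrix k Ω (((monomialRep χ).tprod (monomialRep χ).dual) g m) x y =
      χ (g.left x) * (χ (g.left y) : k)⁻¹ *
        tensorDualMatrix k Ω m (g.right⁻¹ • x) (g.right⁻¹ • y) := by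
  induction m with
  | zero => simp
  | add a b ha hb => simp only [map_add, Matrix.add_apply, ha, hb, mul_add]
  | tmul v f =>
    rw [Representation.tprod_apply, TensorProduct.map_tmul, tensorDualMatrix_tmul,
      tensorDualMatrix_tmul, monomialRep_apply, Representation.dual_apply,
      Module.Dual.transpose_apply, LinearMap.comp_apply, monomialRep_single]
    have hs : ∀ c : k, (Pi.single (g⁻¹.right • y) (c * 1) : Ω → k) =
        c • Pi.single (g.right⁻¹ • y) 1 := fun c ↦ by
      rw [← Pi.single_smul, smul_eq_mul, SemidirectProduct.inv_right]
    rw [hs, map_smul, PermWreath.inv_left_apply, SemidirectProduct.inv_right, smul_inv_smul, map_inv]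
    simp only [smul_eq_mul, Units.val_inv_eq_inv_val]
    ring

/-- The base group does not move pairs, so summing over it only contributes the invertible factor
`|C|^|Ω|`, divided out of a weight for `X`. -/
theorem exists_wreath_weight (k : Type*) [Field k] [Fintype Ω] [DecidableEq Ω]
    [Fintype (PermWreath C X Ω)] [Finite X] [Finite C] (hC : (Nat.card C : k) ≠ 0)
    (hstab : ∀ z : Ω × Ω, z.1 ≠ z.2 → (Nat.card (MulAction.stabilizer X z) : k) ≠ 0) :
    ∃ w : Ω → Ω → k, ∀ x y, ∑ g : PermWreath C X Ω, w (g.right • x) (g.right • y) =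
      if x = y then 0 else 1 := by
  have : Fintype X := Fintype.ofFinite X
  have : Fintype C := Fintype.ofFinite C
  obtain ⟨w, hw⟩ := exists_weight_sum_eq_one k (G := X) (S := {z : Ω × Ω | z.1 ≠ z.2})
    (fun g z hz h ↦ hz (MulAction.injective g h)) hstab
  refine ⟨fun x y ↦ if x = y then 0 else (Nat.card (Ω → C) : k)⁻¹ * w (x, y), fun x y ↦ ?_⟩
  simp only [smul_left_cancel_iff]
  split_ifs with h
  · exact Finset.sum_const_zero
  · have hprod : ∑ g : PermWreath C X Ω, w (g.right • x, g.right • y) =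
        ∑ a : (Ω → C) × X, w (a.2 • x, a.2 • y) :=
      Fintype.sum_equiv SemidirectProduct.equivProd _ _ fun g ↦ rfl
    rw [← Finset.mul_sum, hprod, Fintype.sum_prod_type]
    have h1 : ∑ a : X, w (a • x, a • y) = 1 := hw (x, y) h
    have h2 : (Nat.card (Ω → C) : k) ≠ 0 := by
      rw [Nat.card_fun, Nat.cast_pow]
      exact pow_ne_zero _ hC
    simp only [h1, Finset.sum_const, nsmul_eq_mul, mul_one, Finset.card_univ,
      ← Nat.card_eq_fintype_card]
    exact inv_mul_cancel₀ h2

/-- The monomial representation of a wreath product is endotrivial as soon as its degree is prime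
to the characteristic and the stabilizers of pairs of distinct points are `p'`-groups. -/
theorem monomialRep_isEndotrivial [Finite Ω] [Finite X] [Finite C] (χ : C →* kˣ)
    (hC : (Nat.card C : k) ≠ 0) (hΩ : (Nat.card Ω : k) ≠ 0)
    (hstab : ∀ z : Ω × Ω, z.1 ≠ z.2 → (Nat.card (MulAction.stabilizer X z) : k) ≠ 0) :
    IsEndotrivial (monomialRep χ : Representation k (PermWreath C X Ω) (Ω → k)) := by
  classical
  have : Fintype Ω := Fintype.ofFinite Ω
  have : Finite (PermWreath C X Ω) := Finite.of_equiv _ SemidirectProduct.equivProd.symm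
  have : Fintype (PermWreath C X Ω) := Fintype.ofFinite _
  obtain ⟨w, hw⟩ := exists_wreath_weight k (C := C) hC hstab
  let E := tensorDualMatrix k Ω
  let τ : Representation k (PermWreath C X Ω) _ := (monomialRep χ).tprod (monomialRep χ).dual
  have hE : ∀ g m x y, E (τ g m) x y = χ (g.left x) * (χ (g.left y) : k)⁻¹ *
      E m (g.right⁻¹ • x) (g.right⁻¹ • y) := tensorDualMatrix_monomialRep χ
  have hdiag : ∀ (g : PermWreath C X Ω) (x : Ω), (χ (g.left x) : k) * (χ (g.left x) : k)⁻¹ = 1 :=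
    fun g x ↦ mul_inv_cancel₀ (Units.ne_zero _)
  let tr : τ.IntertwiningMap (Representation.trivial k (PermWreath C X Ω) k) :=
    { toLinearMap := Matrix.traceLinearMap Ω k k ∘ₗ E.toLinearMap
      isIntertwining' := fun g ↦ LinearMap.ext fun m ↦ by
        change ∑ x, E (τ g m) x x = ∑ x, E m x x
        simp only [hE, hdiag, one_mul]
        exact Equiv.sum_comp (MulAction.toPerm g.right⁻¹) fun x ↦ E m x x }
  -- Scaling the identity matrix by `|Ω|⁻¹` gives it trace `1`.
  let ι : (Representation.trivial k (PermWreath C X Ω) k).IntertwiningMap τ :=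
    { toLinearMap := LinearMap.toSpanSingleton k _ (E.symm ((Nat.card Ω : k)⁻¹ • 1))
      isIntertwining' := fun g ↦ LinearMap.ext_ring <| E.injective <| by
        ext x y
        rw [LinearMap.comp_apply, LinearMap.comp_apply, hE, Representation.trivial_apply]
        simp only [LinearMap.toSpanSingleton_apply, one_smul, LinearEquiv.apply_symm_apply,
          Matrix.smul_apply, Matrix.one_apply, smul_left_cancel_iff]
        split_ifs with h
        · rw [h, hdiag, one_mul]
        · simp }
  -- Averaging keeps each off-diagonal entry. At the diagonal place `x` it gives minus the sum of
  -- the other diagonal entries, which is the entry at `x` when the trace is zero.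
  let ψ' : Matrix Ω Ω k →ₗ[k] Matrix Ω Ω k :=
    { toFun := fun m ↦ .of fun x y ↦
        w x y * m x y - if x = y then ∑ z, w x z * m z z else 0
      map_add' := fun a b ↦ by
        ext x y
        simp only [Matrix.of_apply, Matrix.add_apply, mul_add, Finset.sum_add_distrib]
        split_ifs <;> ring
      map_smul' := fun c a ↦ by
        ext x y
        simp only [Matrix.of_apply, Matrix.smul_apply, smul_eq_mul, mul_left_comm _ c,
          ← Finset.mul_sum, RingHom.id_apply]
        split_ifs <;> ring }
  refine IsEndotrivial.of_splitting ι tr (fun c ↦ ?_) (E.symm.toLinearMap ∘ₗ ψ' ∘ₗ E.toLinearMap)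
    fun m hm ↦ E.injective ?_
  · change Matrix.trace (E (c • E.symm ((Nat.card Ω : k)⁻¹ • 1))) = c
    rw [map_smul, E.apply_symm_apply, Matrix.trace_smul, Matrix.trace_smul, Matrix.trace_one,
      ← Nat.card_eq_fintype_card, smul_eq_mul, smul_eq_mul, inv_mul_cancel₀ hΩ, mul_one]
  -- The character factors of `g` and `g⁻¹` cancel, leaving only translated weights.
  · have hterm : ∀ g x y, E (τ g⁻¹ (E.symm (ψ' (E (τ g m))))) x y =
        w (g.right • x) (g.right • y) * E m x y -
          if x = y then ∑ z, w (g.right • x) (g.right • z) * E m z z else 0 := fun g x y ↦ by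
      have hx : (χ (g.left (g.right • x)) : k) ≠ 0 := Units.ne_zero _
      have hy : (χ (g.left (g.right • y)) : k) ≠ 0 := Units.ne_zero _
      have hsum : ∑ z, w (g.right • x) z * E (τ g m) z z =
          ∑ z, w (g.right • x) (g.right • z) * E m z z := by
        rw [← Equiv.sum_comp (MulAction.toPerm g.right)]
        simp only [MulAction.toPerm_apply, hE, hdiag, one_mul, inv_smul_smul]
      rw [hE, E.apply_symm_apply, PermWreath.inv_left_apply, PermWreath.inv_left_apply,
        SemidirectProduct.inv_right, inv_inv]
      change _ * (w (g.right • x) (g.right • y) * E (τ g m) (g.right • x) (g.right • y) -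
        if g.right • x = g.right • y then ∑ z, w (g.right • x) z * E (τ g m) z z else 0) = _
      rw [hsum, hE, inv_smul_smul, inv_smul_smul, map_inv, map_inv, Units.val_inv_eq_inv_val,
        Units.val_inv_eq_inv_val]
      simp only [smul_left_cancel_iff]
      split_ifs with h
      · subst h
        field_simp
      · field_simp
        ring
    have htr : ∑ z, E m z z = 0 := hm
    ext x y
    rw [map_sum, Matrix.sum_apply]
    refine (Finset.sum_congr rfl fun g _ ↦ hterm g x y).trans ?_
    rw [Finset.sum_sub_distrib, ← Finset.sum_mul, hw]
    split_ifs with h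
    · subst h
      rw [Finset.sum_comm]
      simp only [← Finset.sum_mul, hw, ite_mul, zero_mul, one_mul]
      rw [Finset.sum_ite, Finset.sum_const_zero, zero_add, zero_sub, neg_eq_iff_add_eq_zero, ← htr,
        ← Finset.add_sum_erase _ _ (Finset.mem_univ x), add_comm]
      congr 2
      ext z
      simp [eq_comm]
    · rw [Finset.sum_const_zero, sub_zero, one_mul]

end Monomial

/-! ### Induction from the stabilizer of a point -/

section Induced

/-- A representation with a basis of translates of an `H`-semi-invariant vector is induced from
the corresponding linear character of `H`. -/
theorem Representation.nonempty_equiv_ind {k G V ι : Type*} [Field k] [Group G] [AddCommGroup V]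
    [Module k V] (ρ : Representation k G V) (H : Subgroup G) (σ : Representation k H k) (v : V)
    (hv : ∀ h : H, ρ h v = σ h 1 • v) (r : ι → G) (hr : ∀ g : G, ∃ i, ∃ h : H, g = r i * h)
    (b : Module.Basis ι k V) (hb : ∀ i, b i = ρ (r i) v) :
    Nonempty (ρ.Equiv (Representation.ind H.subtype σ)) := by
  have hσ : ∀ (h : H) (c : k), σ h c = c * σ h 1 := fun h c ↦ by
    rw [← smul_eq_mul, ← map_smul, smul_eq_mul, mul_one]
  -- The inverse on `g` is forced: coinvariants identify `(h * g, σ h c)` with `(g, c)`.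
  let Φ₀ : TensorProduct k k[G] k →ₗ[k] V :=
    (Finsupp.linearCombination k fun g : G ↦ ρ g⁻¹ v) ∘ₗ
      (MonoidAlgebra.coeffLinearEquiv k).toLinearMap ∘ₗ (_root_.TensorProduct.rid k k[G]).toLinearMap
  have hΦ₀ : ∀ (g : G) (c : k), Φ₀ (MonoidAlgebra.single g 1 ⊗ₜ c) = c • ρ g⁻¹ v := fun g c ↦ by
    simp [Φ₀]
  let Φ : Representation.IndV H.subtype σ →ₗ[k] V :=
    Representation.Coinvariants.lift _ Φ₀ fun h ↦ by
      refine TensorProduct.ext <| MonoidAlgebra.lhom_ext' fun g ↦ LinearMap.ext_ring <|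
        LinearMap.ext_ring ?_
      have h1 : σ h 1 * σ h⁻¹ 1 = 1 := by
        rw [← hσ, σ.inv_self_apply]
      suffices Φ₀ (MonoidAlgebra.single ((h : G) * g) 1 ⊗ₜ σ h 1) =
          Φ₀ (MonoidAlgebra.single g 1 ⊗ₜ 1) by simpa using this
      rw [hΦ₀, hΦ₀, mul_inv_rev, map_mul, Module.End.mul_apply, ← Subgroup.coe_inv, hv, map_smul,
        smul_smul, h1]
  have hΦ : ∀ (g : G) (c : k), Φ (Representation.IndV.mk H.subtype σ g c) = c • ρ g⁻¹ v := hΦ₀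
  let s : V →ₗ[k] Representation.IndV H.subtype σ :=
    b.constr k fun i ↦ Representation.IndV.mk H.subtype σ (r i)⁻¹ 1
  have hΦs : ∀ x, Φ (s x) = x := fun x ↦ by
    have : Φ ∘ₗ s = LinearMap.id := b.ext fun i ↦ by
      rw [LinearMap.comp_apply, Module.Basis.constr_basis, hΦ, inv_inv, one_smul, hb,
        LinearMap.id_apply]
    exact LinearMap.congr_fun this x
  have hrel : ∀ (h : H) (g : G) (c : k), Representation.IndV.mk H.subtype σ (h * g) (σ h c) =
      Representation.IndV.mk H.subtype σ g c := fun h g c ↦ by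
    have := Representation.Coinvariants.mk_self_apply
      (Representation.tprod ((Representation.leftRegular k G).comp H.subtype) σ) h
      (MonoidAlgebra.single g 1 ⊗ₜ c)
    simpa using this
  have hs : ∀ x, s (Φ x) = x := fun x ↦ by
    have : s ∘ₗ Φ = LinearMap.id := by
      refine Representation.IndV.hom_ext _ _ fun g ↦ LinearMap.ext fun c ↦ ?_
      -- With `g⁻¹ = r i * h`, the class of `(g, c)` is that of `((r i)⁻¹, σ h c)`, on which `s ∘ Φ`
      -- is computed from the basis.
      obtain ⟨i, h, hg⟩ := hr g⁻¹
      obtain rfl : g = (h⁻¹ : H) * (r i)⁻¹ := by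
        rw [← inv_inv g, hg, mul_inv_rev, Subgroup.coe_inv]
      have hc : c = σ h⁻¹ (σ h c) := (σ.inv_self_apply h c).symm
      rw [LinearMap.comp_apply, LinearMap.id_comp]
      conv_rhs => rw [hc, hrel, ← mul_one (σ h c), ← smul_eq_mul, map_smul]
      rw [LinearMap.comp_apply, hΦ, mul_inv_rev, inv_inv, Subgroup.coe_inv, inv_inv, map_mul,
        Module.End.mul_apply, hv, map_smul, map_smul, map_smul, ← hb, smul_smul, Module.Basis.constr_basis, hσ h c]
    exact LinearMap.congr_fun this x
  refine ⟨Representation.Equiv.symm (.mk (LinearEquiv.ofLinearMap Φ s ?_ ?_) fun g ↦ ?_)⟩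
  · exact LinearMap.ext hΦs
  · exact LinearMap.ext hs
  · refine Representation.IndV.hom_ext _ _ fun h ↦ LinearMap.ext fun c ↦ ?_
    change Φ (Representation.ind H.subtype σ g (Representation.IndV.mk H.subtype σ h c)) =
      ρ g (Φ (Representation.IndV.mk H.subtype σ h c))
    rw [Representation.ind_mk, hΦ, hΦ, mul_inv_rev, inv_inv, map_mul, Module.End.mul_apply,
      map_smul]

variable {k : Type u} [Field k] {X C : Type*} [Group X] [CommGroup C] (Y : Subgroup X)

/-- The linear character of `C ≀ Y` given by the value of the base component at the base point. -/
def wreathStabilizerRep (χ : C →* kˣ) :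
    Representation k (Y.comap (SemidirectProduct.rightHom : PermWreath C X (X ⧸ Y) →* X)) k where
  toFun h := (χ (h.1.left (1 : X)) : k) • LinearMap.id
  map_one' := by ext; simp
  map_mul' g h := by
    have hmem : g.1.right ∈ Y := g.2
    have hfix : g.1.right⁻¹ • ((1 : X) : X ⧸ Y) = ((1 : X) : X ⧸ Y) :=
      QuotientGroup.eq.mpr (by simpa using hmem)
    have hval : (g * h).1.left ((1 : X) : X ⧸ Y) = g.1.left (1 : X) * h.1.left (1 : X) := by
      change g.1.left _ * h.1.left (g.1.right⁻¹ • ((1 : X) : X ⧸ Y)) = _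
      rw [hfix]
    rw [hval, map_mul]
    ext
    simp [mul_comm]

theorem monomialRep_nonempty_equiv_ind (χ : C →* kˣ) [Finite (X ⧸ Y)] :
    Nonempty ((monomialRep χ : Representation k (PermWreath C X (X ⧸ Y)) (X ⧸ Y → k)).Equiv
      (Representation.ind (Subgroup.subtype _) (wreathStabilizerRep Y χ))) := by
  classical
  have : Fintype (X ⧸ Y) := Fintype.ofFinite _
  refine Representation.nonempty_equiv_ind _ _ _ (Pi.single ((1 : X) : X ⧸ Y) 1) (fun h ↦ ?_)
    (fun ω : X ⧸ Y ↦ SemidirectProduct.inr ω.out) (fun g ↦ ?_) (Pi.basisFun k (X ⧸ Y)) fun ω ↦ ?_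
  · have hfix : h.1.right • ((1 : X) : X ⧸ Y) = ((1 : X) : X ⧸ Y) :=
      by
      have hmem : h.1.right ∈ Y := h.2
      exact QuotientGroup.eq.mpr (by simpa using hmem)
    rw [monomialRep_single, hfix, ← Pi.single_smul]
    simp [wreathStabilizerRep]
  · refine ⟨(g.right : X ⧸ Y), ⟨(SemidirectProduct.inr (g.right : X ⧸ Y).out)⁻¹ * g, ?_⟩, ?_⟩
    · have hmem : (g.right : X ⧸ Y).out⁻¹ * g.right ∈ Y :=
        QuotientGroup.eq.mp (QuotientGroup.out_eq' _)
      simpa using hmem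
    · simp
  · rw [monomialRep_single]
    simp

end Induced

/-! ### Self-centralizing base group and assembly of the proof -/

/-- In a permutational wreath product over a faithful action, the base group is
self-centralizing. -/
theorem PermWreath.centralizer_ker_le {X Ω C : Type*} [Group X] [MulAction X Ω] [CommGroup C]
    [Nontrivial C] (hfaith : ∀ g : X, (∀ x : Ω, g • x = x) → g = 1) :
    Subgroup.centralizer ((SemidirectProduct.rightHom : PermWreath C X Ω →* X).ker : Set _) ≤
      (SemidirectProduct.rightHom : PermWreath C X Ω →* X).ker := by
  classical
  intro g hg
  obtain ⟨c, hc⟩ := exists_ne (1 : C)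
  refine hfaith _ fun x ↦ ?_
  have h := Subgroup.mem_centralizer_iff.mp hg (SemidirectProduct.inl (Pi.mulSingle x c)) (by simp)
  -- If `g` moved `x`, conjugation by `g` would move the support of this base element from `x` to
  -- `g.right • x`.
  have h1 := congrFun (congrArg SemidirectProduct.left h) (g.right • x)
  change (Pi.mulSingle x c : Ω → C) (g.right • x) * g.left ((1 : X)⁻¹ • g.right • x) =
    g.left (g.right • x) * (Pi.mulSingle x c : Ω → C) (g.right⁻¹ • g.right • x) at h1
  by_contra hne
  have hne' : g.right • x ≠ x := hne
  rw [inv_one, one_smul, inv_smul_smul, Pi.mulSingle_eq_same, Pi.mulSingle_eq_of_ne hne', one_mul,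
    left_eq_mul] at h1
  exact hc h1

/-- Algebraic closedness enters here, to provide a primitive `q`-th root of unity. -/
theorem exists_monoidHom_units_ne_one (k : Type*) [Field k] [IsAlgClosed k] (q : ℕ)
    [Fact q.Prime] (hq : (q : k) ≠ 0) :
    ∃ (χ : Multiplicative (ZMod q) →* kˣ) (c : Multiplicative (ZMod q)), χ c ≠ 1 := by
  have : NeZero (q : k) := ⟨hq⟩
  obtain ⟨ζ, hζ⟩ := HasEnoughRootsOfUnity.exists_primitiveRoot k q
  refine ⟨(AddChar.zmodChar q hζ.pow_eq_one).toMonoidHom.toHomUnits, .ofAdd 1, fun h ↦ ?_⟩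
  refine hζ.ne_one (Fact.out : q.Prime).one_lt ?_
  have h1 := congrArg Units.val h
  rw [MonoidHom.coe_toHomUnits] at h1
  have h2 : AddChar.zmodChar q hζ.pow_eq_one ((1 : ℕ) : ZMod q) = 1 := by simpa using h1
  rwa [AddChar.zmodChar_apply', pow_one] at h2

theorem lemma5 {k : Type u} [Field k] [IsAlgClosed k] (p : ℕ) [Fact p.Prime] [CharP k p]
    {X : Type v} [Group X] [Finite X] (hpX : p ∣ Nat.card X) (hX : pPrimeCore p X = ⊥)
    (Y : Subgroup X) (hY : IsStronglyEmbedded p Y) :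
    ∃ (G : Type v) (_ : Group G) (_ : Finite G) (A : Subgroup G) (_ : A.Normal),
      generalizedFittingSubgroup G = A ∧ IsMulCommutative A ∧ ¬ p ∣ Nat.card A ∧
      Nonempty (G ⧸ A ≃* X) ∧
      ∃ (V : Type (max u v)) (_ : AddCommGroup V) (_ : Module k V) (ρ : Representation k G V),
        ρ.IsIrreducible ∧ IsEndotrivial ρ ∧
        ∃ (H : Subgroup G) (U : Type u) (_ : AddCommGroup U) (_ : Module k U)
          (σ : Representation k H U),
          H ≠ ⊤ ∧ Module.finrank k U = 1 ∧
          Nonempty (ρ.Equiv (Representation.ind H.subtype σ)) := by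
  -- Any prime other than `p` would do.
  obtain ⟨q, hqp, hq⟩ := Nat.exists_infinite_primes (p + 1)
  have : Fact q.Prime := ⟨hq⟩
  have hpq : ¬ p ∣ q := fun h ↦ by
    rw [Nat.prime_dvd_prime_iff_eq Fact.out hq] at h
    omega
  have cast_ne : ∀ n : ℕ, ¬ p ∣ n → (n : k) ≠ 0 := fun n hn ↦
    (CharP.cast_eq_zero_iff k p n).not.mpr hn
  obtain ⟨χ, c, hc⟩ := exists_monoidHom_units_ne_one k q (cast_ne q hpq)
  let C := Multiplicative (ZMod q)
  have hcardC : Nat.card C = q := Nat.card_zmod q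
  let π : PermWreath C X (X ⧸ Y) →* X := SemidirectProduct.rightHom
  have hfin : Finite (PermWreath C X (X ⧸ Y)) := Finite.of_equiv _ SemidirectProduct.equivProd.symm
  have hrange : (SemidirectProduct.inl : (X ⧸ Y → C) →* PermWreath C X (X ⧸ Y)).range = π.ker :=
    SemidirectProduct.range_inl_eq_ker_rightHom
  have hcomm : IsMulCommutative π.ker := by
    refine ⟨⟨?_⟩⟩
    rw [← hrange]
    rintro ⟨_, a, rfl⟩ ⟨_, b, rfl⟩
    ext1
    change SemidirectProduct.inl a * SemidirectProduct.inl b =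
      SemidirectProduct.inl b * SemidirectProduct.inl a
    rw [← map_mul, mul_comm, map_mul]
  have hcard : ¬ p ∣ Nat.card π.ker := by
    rw [← hrange, ← Nat.card_congr (MonoidHom.ofInjective SemidirectProduct.inl_injective).toEquiv,
      Nat.card_fun, hcardC]
    exact fun h ↦ hpq ((Fact.out : p.Prime).dvd_of_dvd_pow h)
  have hF : generalizedFittingSubgroup (PermWreath C X (X ⧸ Y)) = π.ker :=
    generalizedFittingSubgroup_eq_ker p π SemidirectProduct.rightHom_surjective hX hcard
      (PermWreath.centralizer_ker_le fun g hg ↦ hY.eq_one_of_forall_smul_eq hX hg)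
  refine ⟨PermWreath C X (X ⧸ Y), inferInstance, hfin, π.ker, inferInstance, hF, hcomm, hcard,
    ⟨QuotientGroup.quotientKerEquivOfSurjective π SemidirectProduct.rightHom_surjective⟩,
    X ⧸ Y → k, inferInstance, inferInstance, monomialRep χ, monomialRep_isIrreducible hc,
    monomialRep_isEndotrivial χ (cast_ne _ (by rwa [hcardC]))
      (cast_ne _ hY.not_dvd_card_quotient)
      (fun z hz ↦ cast_ne _ (hY.not_dvd_card_stabilizer hz)),
    Y.comap π, k, inferInstance, inferInstance, wreathStabilizerRep Y χ, fun h ↦ hY.1 ?_,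
    Module.finrank_self k, monomialRep_nonempty_equiv_ind Y χ⟩
  exact Subgroup.comap_injective (f := π) SemidirectProduct.rightHom_surjective
    (h.trans (Subgroup.comap_top π).symm)
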